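/- Call an accessible category $\mathcal K$ \emph{locally multipresentable} if it has all small connected limits, and \emph{locally polypresentable} if it has all small wide pullbacks; call $\mathcal K$ \emph{large} if it is not equivalent to a small category. For an object $M$ of an accessible category $\mathcal K$, let the presentability rank $r_{\mathcal K}(M)$ be the least regular cardinal $\lambda$ such that $M$ is $\lambda$-presentable, and let the internal size $|M|_{\mathcal K}$ be $\mu$ if $r_{\mathcal K}(M)=\mu^+$ is a successor cardinal, and $r_{\mathcal K}(M)$ if $r_{\mathcal K}(M)$ is a limit cardinal. Call $\mathcal K$ \emph{weakly LS-accessible} if there is a cardinal $\lambda$ such that for every regular cardinal $\lambda'\ge\lambda$ there is an object $M$ of $\mathcal K$ with $|M|_{\mathcal K}=\lambda'$. (1) Every large locally multipresentable category is weakly LS-accessible. (2) Every large locally polypresentable category in which all morphisms are monomorphisms is weakly LS-accessible. -/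

import Mathlib

open CategoryTheory CategoryTheory.Limits

universe w v u

namespace LSAccessibility

/-- `r` is the presentability rank of `X`: the least regular cardinal `κ` such that `X` is
`κ`-presentable. (Every object of an accessible category has one.) -/
def IsPresentabilityRank {C : Type u} [Category.{v} C] (X : C) (r : Cardinal.{w}) : Prop :=
  IsLeast {κ : Cardinal.{w} | ∃ _ : Fact κ.IsRegular, IsCardinalPresentable X κ} r

/-- `X` has internal size `μ`: either the presentability rank of `X` is the successor
cardinal `μ⁺`, or it is a limit cardinal and equals `μ`. -/
def HasInternalSize {C : Type u} [Category.{v} C] (X : C) (μ : Cardinal.{w}) : Prop :=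
  ∃ r : Cardinal.{w}, IsPresentabilityRank X r ∧
    (r = Order.succ μ ∨ (Order.IsSuccLimit r ∧ r = μ))

/-- A category is weakly LS-accessible if there is a cardinal `κ` such that it has an object
of internal size exactly `μ` for every regular cardinal `μ ≥ κ`. -/
def IsWeaklyLSAccessible (C : Type u) [Category.{v} C] : Prop :=
  ∃ κ : Cardinal.{w}, ∀ μ : Cardinal.{w}, κ ≤ μ → μ.IsRegular →
    ∃ X : C, HasInternalSize X μ

/-- A category is large (relative to the universe `w`) if it is not equivalent to a small one. -/
def IsLarge (C : Type u) [Category.{v} C] : Prop :=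
  ¬ EssentiallySmall.{w} C

/-- A locally multipresentable category is an accessible category with all (small)
connected limits. -/
structure IsLocallyMultipresentable (C : Type u) [Category.{v} C] : Prop where
  isAccessible : IsAccessibleCategory.{w} C
  hasConnectedLimits (J : Type w) [SmallCategory J] [IsConnected J] : HasLimitsOfShape J C

/-- A locally polypresentable category is an accessible category with all (small)
wide pullbacks. -/
structure IsLocallyPolypresentable (C : Type u) [Category.{v} C] : Prop where
  isAccessible : IsAccessibleCategory.{w} C
  hasWidePullbacks : HasWidePullbacks.{w} C

end LSAccessibility

/-! Let μ be regular, at least the accessibility index κ. Over any object K, a small family of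
points (morphisms from generators) has an initial factorization F → K: factoring families give a
solution set, and wide pullbacks and equalizers give the initial object (`exists_isLocallyFree`). F
is λ-presentable if the family has fewer than λ members. Largeness yields a K such that no F built
on fewer than μ points hits all points of K, so recursion picks μ points, each missed by the F of
its predecessors. The F of all μ points is μ⁺-presentable. Were it μ-presentable, its map to the
colimit of the earlier stages would factor through one stage, which would then hit the point it
misses. -/

namespace LSAccessibility

/-- Formal terms built from generators in `S` by joins of families indexed by subsets of a
set of cardinality `κ`. -/
inductive JoinTerm (κ : Cardinal.{w}) (S : Type w) : Type w
  | of (s : S) : JoinTerm κ S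
  | join (T : Set κ.ord.ToType) (f : T → JoinTerm κ S) : JoinTerm κ S

open Classical in
/-- The interpretation of formal terms in a `κ`-directed poset: joins of families of cardinality
`< κ` are interpreted as chosen upper bounds. -/
noncomputable def JoinTerm.eval {κ : Cardinal.{w}} [Fact κ.IsRegular] {S : Type w}
    {α : Type w} [PartialOrder α] [IsCardinalFiltered α κ] (g : S → α) : JoinTerm κ S → α
  | .of s => g s
  | .join T f =>
      if h : HasCardinalLT T κ then IsCardinalFiltered.max (fun t ↦ (f t).eval g) h
      else (IsCardinalFiltered.nonempty α κ).some

/-- This makes the terms κ-directed for the order pulled back along `eval`. -/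
lemma JoinTerm.exists_eval_le {κ : Cardinal.{w}} [Fact κ.IsRegular] {S : Type w}
    {α : Type w} [PartialOrder α] [IsCardinalFiltered α κ] (g : S → α)
    {K : Type w} (hK : Cardinal.mk K < κ) (x : K → JoinTerm κ S) :
    ∃ y : JoinTerm κ S, ∀ k, (x k).eval g ≤ y.eval g := by
  obtain ⟨e⟩ : Nonempty (K ↪ κ.ord.ToType) := by
    rw [← Cardinal.le_def]
    simpa using hK.le
  let e' : K ≃ Set.range e := Equiv.ofInjective e e.injective
  have hT : HasCardinalLT (Set.range e) κ := by
    rw [← hasCardinalLT_iff_of_equiv e', hasCardinalLT_iff_cardinal_mk_lt]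
    exact hK
  refine ⟨.join (Set.range e) (fun t ↦ x (e'.symm t)), fun k ↦ ?_⟩
  rw [JoinTerm.eval, dif_pos hT]
  simpa using leOfHom (IsCardinalFiltered.toMax
    (fun t : Set.range e ↦ (x (e'.symm t)).eval g) hT (e' k))

/-- A `κ`-directed preorder on `W` together with a diagram indexed by it. -/
structure DirectedDiagram (κ : Cardinal.{w}) [Fact κ.IsRegular] (W : Type w)
    (D : Type w) [SmallCategory D] where
  /-- the preorder on the index type -/
  preorder : Preorder W
  isCardinalFiltered : IsCardinalFiltered W κ
  /-- the diagram -/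
  diag : W ⥤ D

/-- In an accessible category, families of morphisms from presentable objects indexed by a given
set `S` factor through objects of a small family. -/
lemma exists_small_factoring_family (C : Type u) [Category.{v} C] (κ : Cardinal.{w})
    [Fact κ.IsRegular] [IsCardinalAccessibleCategory C κ] (S : Type w) :
    ∃ (J : Type w) (H : J → C), ∀ (A : S → C) (_ : ∀ s, IsCardinalPresentable (A s) κ)
      (X : C) (c : ∀ s, A s ⟶ X),
      ∃ (j : J) (k : H j ⟶ X) (d : ∀ s, A s ⟶ H j), ∀ s, d s ≫ k = c s := by
  obtain ⟨P, _, hP⟩ := HasCardinalFilteredGenerator.exists_generator C κ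
  let eq := equivSmallModel.{w} P.FullSubcategory
  -- The index type depends only on κ and `S`, not on `X`, so these diagrams form a small set.
  let I := DirectedDiagram κ (JoinTerm κ S) (SmallModel.{w} P.FullSubcategory)
  have hcolim (i : I) : letI := i.preorder; HasColimit (i.diag ⋙ eq.inverse ⋙ P.ι) := by
    let := i.preorder
    have := i.isCardinalFiltered
    have := HasCardinalFilteredColimits.hasColimitsOfShape (κ := κ) C (JoinTerm κ S)
    infer_instance
  refine ⟨I, fun i ↦ letI := i.preorder; have := hcolim i;
    colimit (i.diag ⋙ eq.inverse ⋙ P.ι), fun A hA X c ↦ ?_⟩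
  obtain ⟨J, _, _, ⟨p⟩⟩ := hP.exists_colimitsOfShape X
  obtain ⟨α, _, _, q, _⟩ := IsCardinalFiltered.exists_cardinal_directed J κ
  have hX : IsColimit (p.cocone.whisker q) :=
    (Functor.Final.isColimitWhiskerEquiv q _).symm p.isColimit
  choose g d hd using fun s ↦ IsCardinalPresentable.exists_hom_of_isColimit κ hX (c s)
  let r : Preorder (JoinTerm κ S) := Preorder.lift (JoinTerm.eval g)
  let ev : JoinTerm κ S ⥤ α := Monotone.functor (f := JoinTerm.eval g) (fun _ _ h ↦ h)
  let G : JoinTerm κ S ⥤ P.FullSubcategory :=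
    P.lift (ev ⋙ q ⋙ p.diag) (fun x ↦ p.prop_diag_obj _)
  let i : I :=
    { preorder := r
      isCardinalFiltered := isCardinalFiltered_preorder _ _
        (fun K x hK ↦ JoinTerm.exists_eval_le g hK x)
      diag := G ⋙ eq.functor }
  have := hcolim i
  let φ : i.diag ⋙ eq.inverse ⋙ P.ι ≅ ev ⋙ q ⋙ p.diag :=
    Functor.isoWhiskerLeft G (Functor.isoWhiskerRight eq.unitIso.symm P.ι)
  let t : Cocone (i.diag ⋙ eq.inverse ⋙ P.ι) :=
    (Cocone.precompose φ.hom).obj ((p.cocone.whisker q).whisker ev)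
  refine ⟨i, colimit.desc _ t,
    fun s ↦ d s ≫ φ.inv.app (.of s) ≫ colimit.ι (i.diag ⋙ eq.inverse ⋙ P.ι) (.of s),
    fun s ↦ ?_⟩
  have key : (φ.inv.app (.of s) ≫ colimit.ι (i.diag ⋙ eq.inverse ⋙ P.ι) (.of s)) ≫
      colimit.desc _ t = ((p.cocone.whisker q).whisker ev).ι.app (.of s) := by
    rw [Category.assoc, colimit.ι_desc]
    exact Iso.inv_hom_id_app_assoc φ (JoinTerm.of s) _
  exact (Category.assoc _ _ _).trans ((congrArg (d s ≫ ·) key).trans (hd s))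

/-! ### Locally free families -/

variable {C : Type u} [Category.{v} C]

/-- A family of morphisms `b s : A s ⟶ F` is locally free if it is initial in its connected
component of the category of families of morphisms from the objects `A s` to an object. -/
def IsLocallyFree {S : Type w} {A : S → C} {F : C} (b : ∀ s, A s ⟶ F) : Prop :=
  ∀ ⦃L X : C⦄ (h : F ⟶ L) (k : X ⟶ L) (c : ∀ s, A s ⟶ X), (∀ s, c s ≫ k = b s ≫ h) →
    ∃! f : F ⟶ X, f ≫ k = h ∧ ∀ s, b s ≫ f = c s

/-- An object with a locally free family indexed by a set of cardinality `< κ` with `κ`-presentable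
sources is `κ`-presentable. -/
lemma IsLocallyFree.isCardinalPresentable {S : Type w} {A : S → C} {F : C} {b : ∀ s, A s ⟶ F}
    (hb : IsLocallyFree b) (κ : Cardinal.{w}) [Fact κ.IsRegular]
    (hA : ∀ s, IsCardinalPresentable (A s) κ) (hS : HasCardinalLT S κ) :
    IsCardinalPresentable F κ where
  preservesColimitOfShape J _ _ := ⟨fun {D} ↦ ⟨fun {c} hc ↦ ⟨by
    have := essentiallySmallSelf J
    have := isFiltered_of_isCardinalFiltered J κ
    refine Types.FilteredColimit.isColimitOf' _ _ (fun (f : F ⟶ c.pt) ↦ ?_)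
      (fun j (f₁ : F ⟶ D.obj j) (f₂ : F ⟶ D.obj j) (hf : f₁ ≫ c.ι.app j = f₂ ≫ c.ι.app j) ↦ ?_)
    · choose j g hg using fun s ↦ IsCardinalPresentable.exists_hom_of_isColimit κ hc (b s ≫ f)
      obtain ⟨f', ⟨h₁, -⟩, -⟩ := hb f (c.ι.app (IsCardinalFiltered.max j hS))
        (fun s ↦ g s ≫ D.map (IsCardinalFiltered.toMax j hS s)) (fun s ↦ by simp [hg])
      exact ⟨_, f', h₁.symm⟩
    · choose i u hu using fun s ↦ IsCardinalPresentable.exists_eq_of_isColimit' κ hc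
        (b s ≫ f₁) (b s ≫ f₂) (by simp [hf])
      obtain ⟨m, a, v, hv⟩ := IsCardinalFiltered.wideSpan u hS
      refine ⟨m, v, (hb (f₁ ≫ c.ι.app j) (c.ι.app m) (fun s ↦ b s ≫ f₁ ≫ D.map v)
        (by simp)).unique ⟨?_, ?_⟩ ⟨?_, ?_⟩⟩
      · simp
      · intro s; rfl
      · simp [hf]
      · intro s
        have := hu s =≫ D.map (a s)
        simp only [Category.assoc, ← D.map_comp, hv] at this
        exact this.symm⟩⟩⟩

section Existence

variable (hE : ∀ ⦃X Y Z : C⦄ (u v : X ⟶ Y) (k : Y ⟶ Z), u ≫ k = v ≫ k → HasEqualizer u v)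

include hE in
/-- A family that is initial among the factorizations of its composition with a fixed
morphism is locally free. -/
lemma isLocallyFree_of_initial [HasPullbacks C] {S : Type w} {A : S → C} {F K : C}
    (b : ∀ s, A s ⟶ F) (g : F ⟶ K)
    (H : ∀ ⦃X : C⦄ (k : X ⟶ K) (c : ∀ s, A s ⟶ X), (∀ s, c s ≫ k = b s ≫ g) →
      ∃! f : F ⟶ X, f ≫ k = g ∧ ∀ s, b s ≫ f = c s) :
    IsLocallyFree b := by
  -- Initiality over `K` splits every morphism to `F` through which `b` lifts; apply this to a
  -- pullback for existence, to an equalizer for uniqueness.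
  have section_of {X : C} (k : X ⟶ F) (c : ∀ s, A s ⟶ X) (hc : ∀ s, c s ≫ k = b s) :
      ∃ t : F ⟶ X, t ≫ k = 𝟙 F ∧ ∀ s, b s ≫ t = c s := by
    obtain ⟨t, ⟨h₁, h₂⟩, -⟩ := H (k ≫ g) c (fun s ↦ by rw [reassoc_of% hc s])
    refine ⟨t, (H g b (fun _ ↦ rfl)).unique ⟨by simpa using h₁, fun s ↦ ?_⟩
      ⟨Category.id_comp _, fun s ↦ Category.comp_id _⟩, h₂⟩
    rw [reassoc_of% h₂ s, hc]
  intro L X h k c hc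
  obtain ⟨t, h₁, h₂⟩ := section_of (pullback.fst h k)
    (fun s ↦ pullback.lift (b s) (c s) (hc s).symm) (fun s ↦ pullback.lift_fst _ _ _)
  refine ⟨t ≫ pullback.snd h k, ⟨?_, fun s ↦ ?_⟩, fun f ⟨hf₁, hf₂⟩ ↦ ?_⟩
  · rw [Category.assoc, ← pullback.condition, reassoc_of% h₁]
  · rw [reassoc_of% h₂ s, pullback.lift_snd]
  · have e₁ : (t ≫ pullback.snd h k) ≫ k = h := by
      rw [Category.assoc, ← pullback.condition, reassoc_of% h₁]
    have e₂ (s) : b s ≫ t ≫ pullback.snd h k = c s := by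
      rw [reassoc_of% h₂ s, pullback.lift_snd]
    have := hE f (t ≫ pullback.snd h k) k (hf₁.trans e₁.symm)
    obtain ⟨r, hr, -⟩ := section_of (equalizer.ι f (t ≫ pullback.snd h k))
      (fun s ↦ equalizer.lift (b s) ((hf₂ s).trans (e₂ s).symm)) (fun s ↦ by simp)
    rw [← Category.id_comp f, ← hr, Category.assoc, equalizer.condition, reassoc_of% hr]

include hE in
/-- Locally free families exist as soon as there is a weakly initial small set of
factorizations. -/
lemma exists_isLocallyFree [LocallySmall.{w} C] [HasWidePullbacks.{w} C]
    {S : Type w} {A : S → C} {J : Type w} (H : J → C)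
    (hH : ∀ (X : C) (c : ∀ s, A s ⟶ X),
      ∃ (j : J) (k : H j ⟶ X) (d : ∀ s, A s ⟶ H j), ∀ s, d s ≫ k = c s)
    {K : C} (a : ∀ s, A s ⟶ K) :
    ∃ (F : C) (b : ∀ s, A s ⟶ F) (g : F ⟶ K), (∀ s, b s ≫ g = a s) ∧ IsLocallyFree b := by
  let Θ := Σ j : J, { x : (H j ⟶ K) × (∀ s, A s ⟶ H j) // ∀ s, x.2 s ≫ x.1 = a s }
  have : Small.{w} Θ := inferInstance
  let σ : Shrink.{w} Θ → Θ := (equivShrink Θ).symm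
  let arr (θ : Shrink.{w} Θ) : H (σ θ).1 ⟶ K := (σ θ).2.1.1
  let Q := widePullback K _ arr
  let q : Q ⟶ K := WidePullback.base arr
  let c (s : S) : A s ⟶ Q :=
    WidePullback.lift (a s) (fun θ ↦ (σ θ).2.1.2 s) (fun θ ↦ (σ θ).2.2 s)
  have hc (s) : c s ≫ q = a s := WidePullback.lift_base _ _ _ _
  have hQ {X : C} (k : X ⟶ K) (x : ∀ s, A s ⟶ X) (hx : ∀ s, x s ≫ k = a s) :
      ∃ f : Q ⟶ X, f ≫ k = q ∧ ∀ s, c s ≫ f = x s := by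
    obtain ⟨j, m, d, hd⟩ := hH X x
    let θ₀ : Θ := ⟨j, ⟨(m ≫ k, d), fun s ↦ by simp [reassoc_of% hd s, hx]⟩⟩
    obtain ⟨θ, hθ⟩ : ∃ θ, σ θ = θ₀ := (equivShrink Θ).symm.surjective θ₀
    have key : ∀ θ' : Θ, σ θ = θ' → ∃ f : Q ⟶ H θ'.1, f ≫ θ'.2.1.1 = q ∧
        ∀ s, c s ≫ f = θ'.2.1.2 s := by
      rintro _ rfl
      exact ⟨WidePullback.π arr θ, WidePullback.π_arrow arr θ,
        fun s ↦ WidePullback.lift_π _ _ _ _ _⟩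
    obtain ⟨f, hf₁, hf₂⟩ := key θ₀ hθ
    exact ⟨f ≫ m, by simpa [θ₀] using hf₁, fun s ↦ by rw [reassoc_of% hf₂ s]; exact hd s⟩
  -- `Q` is only weakly initial; the equalizer of `u` and `v` equalizes all its endomorphisms at
  -- once.
  let E := { e : Q ⟶ Q // e ≫ q = q ∧ ∀ s, c s ≫ e = c s }
  have : Small.{w} E := inferInstance
  let τ : Shrink.{w} E → E := (equivShrink E).symm
  let R := widePullback K (fun _ : Shrink.{w} E ↦ Q) (fun _ ↦ q)
  let u : Q ⟶ R := WidePullback.lift q (fun _ ↦ 𝟙 Q) (fun _ ↦ by simp)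
  let v : Q ⟶ R := WidePullback.lift q (fun e ↦ (τ e).1) (fun e ↦ (τ e).2.1)
  let π (e : Shrink.{w} E) : R ⟶ Q := WidePullback.π (fun _ ↦ q) e
  have huv : u ≫ WidePullback.base _ = v ≫ WidePullback.base _ :=
    (WidePullback.lift_base _ _ _ _).trans (WidePullback.lift_base _ _ _ _).symm
  have hu (e) : u ≫ π e = 𝟙 Q := WidePullback.lift_π _ _ _ _ _
  have hv (e) : v ≫ π e = (τ e).1 := WidePullback.lift_π _ _ _ _ _
  have := hE u v _ huv
  have hι (e : Q ⟶ Q) (he : e ≫ q = q) (he' : ∀ s, c s ≫ e = c s) :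
      equalizer.ι u v ≫ e = equalizer.ι u v := by
    have h := equalizer.condition u v =≫ π (equivShrink E ⟨e, he, he'⟩)
    rw [Category.assoc, Category.assoc, hu, hv, Category.comp_id] at h
    simpa [τ] using h.symm
  have hcuv (s : S) : c s ≫ u = c s ≫ v := by
    apply WidePullback.hom_ext
    · intro e
      change (c s ≫ u) ≫ π e = (c s ≫ v) ≫ π e
      rw [Category.assoc, Category.assoc, hu, hv, (τ e).2.2 s, Category.comp_id]
    · rw [Category.assoc, Category.assoc, huv]
  let b (s : S) : A s ⟶ equalizer u v := equalizer.lift (c s) (hcuv s)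
  have hb (s) : b s ≫ equalizer.ι u v = c s := equalizer.lift_ι _ _
  refine ⟨equalizer u v, b, equalizer.ι u v ≫ q, fun s ↦ by rw [reassoc_of% hb s, hc],
    isLocallyFree_of_initial hE _ (equalizer.ι u v ≫ q) (fun X k x hx ↦ ?_)⟩
  simp only [reassoc_of% hb, hc] at hx
  obtain ⟨f, hf₁, hf₂⟩ := hQ k x hx
  refine ⟨equalizer.ι u v ≫ f, ⟨by simp [hf₁], fun s ↦ by rw [reassoc_of% hb s, hf₂]⟩,
    fun f' ⟨h₁, h₂⟩ ↦ ?_⟩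
  have := hE f' (equalizer.ι u v ≫ f) k (by simp [h₁, hf₁])
  obtain ⟨t, ht₁, ht₂⟩ := hQ (equalizer.ι f' (equalizer.ι u v ≫ f) ≫ equalizer.ι u v ≫ q)
    (fun s ↦ equalizer.lift (b s) (by rw [h₂, reassoc_of% hb s, hf₂]))
    (fun s ↦ by rw [equalizer.lift_ι_assoc, reassoc_of% hb s, hc])
  have hid : (equalizer.ι u v ≫ t) ≫ equalizer.ι f' (equalizer.ι u v ≫ f) = 𝟙 _ := by
    rw [← cancel_mono (equalizer.ι u v), Category.id_comp]
    simp only [Category.assoc]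
    exact hι _ (by simpa using ht₁)
      (fun s ↦ by rw [reassoc_of% ht₂ s, equalizer.lift_ι_assoc, hb])
  rw [← Category.id_comp f', ← hid, Category.assoc, equalizer.condition,
    ← Category.assoc, hid, Category.id_comp]

end Existence

/-! ### Largeness and images of small families -/

section Large

variable {P : ObjectProperty C} {κ : Cardinal.{w}} [Fact κ.IsRegular]

/-- A morphism `h` that is surjective on morphisms from a generator factors any morphism that
identifies the pairs identified by `h`. -/
lemma exists_comp_eq_of_generator (hP : P.IsCardinalFilteredGenerator κ) {H K K' : C}
    (h : H ⟶ K) (h' : H ⟶ K')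
    (hsurj : ∀ A, P A → ∀ a : A ⟶ K, ∃ x : A ⟶ H, x ≫ h = a)
    (hrel : ∀ A, P A → ∀ x y : A ⟶ H, x ≫ h = y ≫ h → x ≫ h' = y ≫ h') :
    ∃ φ : K ⟶ K', h ≫ φ = h' := by
  obtain ⟨J, _, _, ⟨p⟩⟩ := hP.exists_colimitsOfShape K
  choose x hx using fun j ↦ hsurj _ (p.prop_diag_obj j) (p.ι.app j)
  let t : Cocone p.diag :=
    { pt := K'
      ι :=
        { app j := x j ≫ h'
          naturality i j f := by
            have := hrel _ (p.prop_diag_obj i) (p.diag.map f ≫ x j) (x i)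
              (by rw [Category.assoc, hx, hx]; exact p.cocone.w f)
            simpa using this } }
  have ht (j) : p.ι.app j ≫ p.isColimit.desc t = x j ≫ h' := p.isColimit.fac t j
  refine ⟨p.isColimit.desc t, hP.isStrongGenerator.isSeparating _ _ (fun A hA y ↦ ?_)⟩
  have : IsCardinalPresentable A κ := hP.le_isCardinalPresentable _ hA
  have := essentiallySmallSelf J
  obtain ⟨j, z, hz⟩ := IsCardinalPresentable.exists_hom_of_isColimit κ p.isColimit (y ≫ h)
  change z ≫ p.ι.app j = y ≫ h at hz
  rw [← reassoc_of% hz, ht, ← Category.assoc]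
  exact hrel A hA _ _ (by rw [Category.assoc, hx, hz])

/-- Two objects that are images of the same object, by morphisms that are surjective on morphisms
from a generator and identify the same pairs, are isomorphic. -/
lemma nonempty_iso_of_generator (hP : P.IsCardinalFilteredGenerator κ) {H K K' : C}
    (h : H ⟶ K) (h' : H ⟶ K')
    (hsurj : ∀ A, P A → ∀ a : A ⟶ K, ∃ x : A ⟶ H, x ≫ h = a)
    (hsurj' : ∀ A, P A → ∀ a : A ⟶ K', ∃ x : A ⟶ H, x ≫ h' = a)
    (hrel : ∀ A, P A → ∀ x y : A ⟶ H, x ≫ h = y ≫ h ↔ x ≫ h' = y ≫ h') :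
    Nonempty (K ≅ K') := by
  have epi {L : C} (l : H ⟶ L) (hl : ∀ A, P A → ∀ a : A ⟶ L, ∃ x : A ⟶ H, x ≫ l = a) :
      Epi l := ⟨fun u v huv ↦ hP.isStrongGenerator.isSeparating _ _ (fun A hA a ↦ by
        obtain ⟨x, rfl⟩ := hl A hA a
        rw [Category.assoc, Category.assoc, huv])⟩
  have := epi h hsurj
  have := epi h' hsurj'
  obtain ⟨φ, hφ⟩ := exists_comp_eq_of_generator hP h h' hsurj (fun A hA x y ↦ (hrel A hA x y).1)
  obtain ⟨ψ, hψ⟩ := exists_comp_eq_of_generator hP h' h hsurj' (fun A hA x y ↦ (hrel A hA x y).2)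
  exact ⟨⟨φ, ψ, by rw [← cancel_epi h, reassoc_of% hφ, hψ, Category.comp_id],
    by rw [← cancel_epi h', reassoc_of% hψ, hφ, Category.comp_id]⟩⟩

/-- In a large accessible category there are objects which are not images of the
objects of a given small family. -/
lemma IsLarge.exists_not_surjective (hC : IsLarge.{w} C) [LocallySmall.{w} C]
    [ObjectProperty.Small.{w} P] (hP : P.IsCardinalFilteredGenerator κ)
    {J : Type w} (H : J → C) :
    ∃ K : C, ∀ (j : J) (h : H j ⟶ K), ∃ A, P A ∧ ∃ a : A ⟶ K, ∀ x : A ⟶ H j, x ≫ h ≠ a := by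
  by_contra! hK
  choose j h hsurj using hK
  -- The source and the kernel relation on points determine `K` up to isomorphism, and there is only
  -- a small set of such codes.
  let code (K : C) : Σ j : J, ∀ A : Subtype P, (A.1 ⟶ H j) → (A.1 ⟶ H j) → Prop :=
    ⟨j K, fun A x y ↦ x ≫ h K = y ≫ h K⟩
  have hcode (K K' : C) (e : code K = code K') : Nonempty (K ≅ K') := by
    have key : ∀ c, code K' = c → ∃ h' : H c.1 ⟶ K',
        (∀ A, P A → ∀ a : A ⟶ K', ∃ x : A ⟶ H c.1, x ≫ h' = a) ∧
        ∀ A x y, c.2 A x y ↔ x ≫ h' = y ≫ h' := by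
      rintro _ rfl
      exact ⟨h K', hsurj K', fun A x y ↦ Iff.rfl⟩
    obtain ⟨h', h₁, h₂⟩ := key (code K) e.symm
    exact nonempty_iso_of_generator hP (h K) h' (hsurj K) h₁
      (fun A hA x y ↦ h₂ ⟨A, hA⟩ x y)
  have : Small.{w} (Subtype P) := inferInstanceAs (ObjectProperty.Small.{w} P)
  refine hC ((essentiallySmall_iff C).2 ⟨?_, inferInstance⟩)
  refine small_of_injective (f := fun X : Skeleton C ↦ code ((fromSkeleton C).obj X))
    (fun X Y hXY ↦ ?_)
  obtain ⟨e⟩ := hcode _ _ hXY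
  exact skeleton_skeletal C ⟨(fromSkeleton C).preimageIso e⟩

end Large

/-! ### Objects of prescribed size -/

lemma hasInternalSize_of_isCardinalPresentable_succ {X : C} {μ : Cardinal.{w}}
    [hμ : Fact μ.IsRegular] [Fact (Order.succ μ).IsRegular]
    (h₁ : IsCardinalPresentable X (Order.succ μ)) (h₂ : ¬ IsCardinalPresentable X μ) :
    HasInternalSize X μ := by
  refine ⟨Order.succ μ, ⟨⟨inferInstance, h₁⟩, fun κ ⟨_, hκ⟩ ↦ ?_⟩, Or.inl rfl⟩
  by_contra! hlt
  exact h₂ (isCardinalPresentable_of_le X (Order.lt_succ_iff.1 hlt))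

/-- A large accessible category with wide pullbacks, and with equalizers of those parallel pairs
which are coequalized by some morphism, is weakly LS-accessible. -/
theorem IsLarge.isWeaklyLSAccessible (hC : IsLarge.{w} C) [hacc : IsAccessibleCategory.{w} C]
    [HasWidePullbacks.{w} C]
    (hE : ∀ ⦃X Y Z : C⦄ (u v : X ⟶ Y) (k : Y ⟶ Z), u ≫ k = v ≫ k → HasEqualizer u v) :
    IsWeaklyLSAccessible.{w} C := by
  obtain ⟨κ, _, _⟩ := hacc.exists_cardinal
  refine ⟨κ, fun μ hκμ hμ ↦ ?_⟩
  have : Fact μ.IsRegular := ⟨hμ⟩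
  have : Fact (Order.succ μ).IsRegular := ⟨Cardinal.isRegular_succ hμ.aleph0_le⟩
  have : NoMaxOrder μ.ord.ToType := Cardinal.noMaxOrder hμ.aleph0_le
  obtain ⟨P, _, hP⟩ := HasCardinalFilteredGenerator.exists_small_generator C κ
  choose J H hH using fun T : Type w ↦ exists_small_factoring_family C κ T
  have hpres (A : Subtype P) : IsCardinalPresentable A.1 κ := hP.le_isCardinalPresentable _ A.2
  obtain ⟨K, hK⟩ := hC.exists_not_surjective hP
    (fun x : Σ i : μ.ord.ToType, J (Set.Iio i) ↦ H _ x.2)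
  choose F b g hg hfree using fun (T : Type w) (a : T → Σ A : Subtype P, A.1 ⟶ K) ↦
    exists_isLocallyFree hE (H T) (hH T _ (fun t ↦ hpres (a t).1)) (fun t ↦ (a t).2)
  have step (i : μ.ord.ToType) (a : Set.Iio i → Σ A : Subtype P, A.1 ⟶ K) :
      ∃ e : Σ A : Subtype P, A.1 ⟶ K, ∀ x : e.1.1 ⟶ F _ a, x ≫ g _ a ≠ e.2 := by
    -- Local freeness makes `F` a retract of some `H j`, so a point missed by `H j` is missed by
    -- `F`.
    obtain ⟨j, k, d, hd⟩ := hH _ _ (fun t ↦ hpres (a t).1) (F _ a) (b _ a)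
    obtain ⟨r, ⟨hr, -⟩, -⟩ := hfree _ a (𝟙 _) k d (by simpa using hd)
    obtain ⟨A, hA, y, hy⟩ := hK ⟨i, j⟩ (k ≫ g _ a)
    refine ⟨⟨⟨A, hA⟩, y⟩, fun x hx ↦ hy (x ≫ r) ?_⟩
    rw [Category.assoc, reassoc_of% hr, hx]
  choose next hnext using step
  let s : μ.ord.ToType → Σ A : Subtype P, A.1 ⟶ K :=
    (wellFounded_lt (α := μ.ord.ToType)).fix (fun i rec ↦ next i (fun j ↦ rec j.1 j.2))
  have hs (i) : s i = next i (fun j ↦ s j) := WellFounded.fix_eq _ _ _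
  let sub (i : μ.ord.ToType) (j : Set.Iio i) : Σ A : Subtype P, A.1 ⟶ K := s j
  have hnot (i) (x : (s i).1.1 ⟶ F _ (sub i)) : x ≫ g _ (sub i) ≠ (s i).2 := by
    have := hnext i (sub i)
    rw [← hs i] at this
    exact this x
  have hmap (i j : μ.ord.ToType) (hij : i ≤ j) := hfree _ (sub i) (g _ (sub i)) (g _ (sub j))
    (fun t ↦ b _ (sub j) ⟨t.1, t.2.trans_le hij⟩)
    (fun t ↦ (hg _ (sub j) _).trans (hg _ (sub i) t).symm)
  let D : μ.ord.ToType ⥤ C :=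
    { obj i := F _ (sub i)
      map f := (hmap _ _ (leOfHom f)).choose
      map_id i := (hmap i i le_rfl).unique (hmap i i le_rfl).choose_spec.1
        ⟨Category.id_comp _, fun t ↦ Category.comp_id _⟩
      map_comp {i j k} f f' := by
        have h₁ := (hmap _ _ (leOfHom f)).choose_spec.1
        have h₂ := (hmap _ _ (leOfHom f')).choose_spec.1
        refine (hmap _ _ (leOfHom (f ≫ f'))).unique
          (hmap _ _ (leOfHom (f ≫ f'))).choose_spec.1 ⟨?_, fun t ↦ ?_⟩
        · rw [Category.assoc, h₂.1, h₁.1]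
        · rw [← Category.assoc, h₁.2 t]
          exact h₂.2 ⟨t.1, t.2.trans_le (leOfHom f)⟩ }
  have := IsCardinalFiltered.of_le μ.ord.ToType hκμ
  have := HasCardinalFilteredColimits.hasColimitsOfShape (κ := κ) C μ.ord.ToType
  let t : Cocone D :=
    { pt := K
      ι :=
        { app i := g _ (sub i)
          naturality i j f := by
            simpa [D] using (hmap _ _ (leOfHom f)).choose_spec.1.1 } }
  refine ⟨F _ s, hasInternalSize_of_isCardinalPresentable_succ ?_ (fun hF ↦ ?_)⟩
  · refine (hfree _ s).isCardinalPresentable _ (fun i ↦ ?_) ?_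
    · have := hpres (s i).1
      exact isCardinalPresentable_of_le _ (hκμ.trans (Order.le_succ μ))
    · simp [hasCardinalLT_iff_cardinal_mk_lt]
  -- Stage `i` contains only the points before `i`, so point `i` first appears at the successor
  -- stage.
  · let up (i : μ.ord.ToType) : Set.Iio (Order.succ i) := ⟨i, Order.lt_succ i⟩
    obtain ⟨f, ⟨hf, -⟩, -⟩ := hfree _ s (g _ s) (colimit.desc D t)
      (fun i ↦ b _ (sub (Order.succ i)) (up i) ≫ colimit.ι D (Order.succ i)) (fun i ↦ by
        rw [Category.assoc, colimit.ι_desc, hg]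
        exact (hg _ s i).symm)
    have := essentiallySmallSelf μ.ord.ToType
    obtain ⟨i, f', hf'⟩ :=
      IsCardinalPresentable.exists_hom_of_isColimit μ (colimit.isColimit D) f
    refine hnot i (b _ s i ≫ f') ?_
    have h : f' ≫ g _ (sub i) = g _ s := by
      rw [← hf, ← hf', Category.assoc]
      exact congrArg (f' ≫ ·) (colimit.ι_desc t i).symm
    rw [Category.assoc, h, hg]

lemma IsLocallyMultipresentable.hasWidePullbacks (h : IsLocallyMultipresentable.{w} C) :
    HasWidePullbacks.{w} C :=
  fun _ ↦ h.hasConnectedLimits _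

lemma IsLocallyMultipresentable.hasEqualizers (h : IsLocallyMultipresentable.{w} C) :
    HasEqualizers C := by
  have e : WalkingParallelPair ≌ ULiftHom.{w} (ULift.{w} WalkingParallelPair) :=
    ULiftHomULiftCategory.equiv.{w, w} WalkingParallelPair
  have : IsConnected (ULiftHom.{w} (ULift.{w} WalkingParallelPair)) :=
    isConnected_of_equivalent e
  have := h.hasConnectedLimits (ULiftHom.{w} (ULift.{w} WalkingParallelPair))
  exact hasLimitsOfShape_of_equivalence e.symm

end LSAccessibility

theorem mainTheorem8 (C : Type u) [Category.{v} C] (hC : LSAccessibility.IsLarge.{w} C) :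
    (LSAccessibility.IsLocallyMultipresentable.{w} C →
      LSAccessibility.IsWeaklyLSAccessible.{w} C) ∧
    (LSAccessibility.IsLocallyPolypresentable.{w} C →
      (∀ (X Y : C) (f : X ⟶ Y), Mono f) →
        LSAccessibility.IsWeaklyLSAccessible.{w} C) := by
  refine ⟨fun h ↦ ?_, fun h hmono ↦ ?_⟩
  · have := h.isAccessible
    have := h.hasWidePullbacks
    have := h.hasEqualizers
    exact hC.isWeaklyLSAccessible (fun _ _ _ u v _ _ ↦ inferInstance)
  · have := h.isAccessible
    have := h.hasWidePullbacks
    refine hC.isWeaklyLSAccessible (fun X Y Z u v k huv ↦ ?_)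
    have := hmono Y Z k
    obtain rfl : u = v := (cancel_mono k).1 huv
    infer_instance
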